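/- All spaces are Hausdorff. For open subsets $U,V$ of a topological space $X$ write $U\le V$ if $\overline U\subseteq V$ or $U=V$. A *tunnel* in $X$ is a family $\mathscr W$ of open subsets of $X$ that is linearly ordered by $\le$ and such that $\bigcup\{\partial U : U\in\mathscr W\}$ is dense in $X$. Let $(K_i)_{i\in I}$ be a family of nonempty compact Hausdorff spaces and let $\mathscr U$ be a countably incomplete ultrafilter on $I$ (that is, there are sets $A_0,A_1,\dots\in\mathscr U$ with $\bigcap_n A_n=\varnothing$). Let $C(K_i)$ be the Banach algebra of continuous functions $K_i\to\mathbb R$ with the supremum norm, and let $[C(K_i)]_{\mathscr U}$ be the Banach-algebra ultraproduct, i.e. the quotient of the algebra of all bounded families $(f_i)$, $f_i\in C(K_i)$, with the norm $\sup_i\|f_i\|$, by the closed ideal of those families with $\lim_{\mathscr U}\|f_i\|=0$. The topological ultracoproduct $(K_i)^{\mathscr U}$ is the spectrum of $[C(K_i)]_{\mathscr U}$: the space of its nonzero continuous multiplicative linear functionals into $\mathbb R$, with the weak* topology. If every $K_i$ has a tunnel, then $(K_i)^{\mathscr U}$ has a tunnel. -/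

import Mathlib

open Filter Topology
open scoped ENNReal

namespace Tunnels

/-- The order on open sets: `U ≤ V` if the closure of `U` is contained in `V`, or `U = V`. -/
def ChainLE {X : Type*} [TopologicalSpace X] (U V : Set X) : Prop :=
  closure U ⊆ V ∨ U = V

/-- A tunnel in `X`: a family of open sets, linearly ordered by `ChainLE`, the boundaries of whose
members have dense union. -/
structure IsTunnel {X : Type*} [TopologicalSpace X] (W : Set (Set X)) : Prop where
  isOpen : ∀ U ∈ W, IsOpen U
  chain : ∀ U ∈ W, ∀ V ∈ W, ChainLE U V ∨ ChainLE V U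
  dense : Dense (⋃ U ∈ W, frontier U)

/-- The space `X` has a tunnel. -/
def HasTunnel (X : Type*) [TopologicalSpace X] : Prop :=
  ∃ W : Set (Set X), IsTunnel W

/-- An ultrafilter is countably incomplete if it has countably many members with empty
intersection. -/
def CountablyIncomplete {I : Type*} (𝒰 : Ultrafilter I) : Prop :=
  ∃ A : ℕ → Set I, (∀ n, A n ∈ 𝒰) ∧ ⋂ n, A n = ∅

section Ultracoproduct

variable {I : Type*} (K : I → Type*) [∀ i, TopologicalSpace (K i)] [∀ i, CompactSpace (K i)]
  [∀ i, Nonempty (K i)]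

/-- The Banach algebra of bounded families `(f i)` with `f i ∈ C(K i)`, with pointwise operations
and the supremum norm. -/
def BoundedFamilies : Type _ := lp (fun i => C(K i, ℝ)) ∞

instance : CoeFun (BoundedFamilies K) (fun _ => ∀ i, C(K i, ℝ)) := ⟨fun f => f.1⟩

noncomputable instance : NormedCommRing (BoundedFamilies K) :=
  inferInstanceAs (NormedCommRing (lp (fun i => C(K i, ℝ)) ∞))

noncomputable instance : NormedAlgebra ℝ (BoundedFamilies K) :=
  inferInstanceAs (NormedAlgebra ℝ (lp (fun i => C(K i, ℝ)) ∞))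

theorem BoundedFamilies.norm_apply_le (f : BoundedFamilies K) (i : I) : ‖f i‖ ≤ ‖f‖ :=
  lp.norm_apply_le_norm (E := fun i => C(K i, ℝ)) ENNReal.top_ne_zero f i

/-- The ideal of the bounded families whose norms tend to zero along the ultrafilter. -/
def nullIdeal (𝒰 : Ultrafilter I) : Ideal (BoundedFamilies K) where
  carrier := {f | Tendsto (fun i => ‖f i‖) 𝒰 (𝓝 0)}
  zero_mem' := by
    change Tendsto (fun i => ‖(0 : C(K i, ℝ))‖) 𝒰 (𝓝 0)
    simp
  add_mem' := by
    intro f g hf hg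
    refine squeeze_zero (fun i => norm_nonneg _) (fun i => ?_) (by simpa using Tendsto.add hf hg)
    exact norm_add_le (f i) (g i)
  smul_mem' := by
    intro c f hf
    refine squeeze_zero (g := fun i => ‖c‖ * ‖f i‖) (fun i => norm_nonneg _) (fun i => ?_)
      (by simpa using Tendsto.const_mul ‖c‖ hf)
    exact (norm_mul_le (c i) (f i)).trans
      (mul_le_mul_of_nonneg_right (c.norm_apply_le K i) (norm_nonneg _))

/-- The null ideal is closed, so the quotient by it is a normed algebra. -/
instance isClosed_nullIdeal (𝒰 : Ultrafilter I) :
    IsClosed (nullIdeal K 𝒰 : Set (BoundedFamilies K)) := by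
  refine isClosed_of_closure_subset fun f hf => ?_
  refine Metric.tendsto_nhds.2 fun ε hε => ?_
  obtain ⟨g, hg, hfg⟩ := Metric.mem_closure_iff.1 hf (ε / 2) (half_pos hε)
  filter_upwards [Metric.tendsto_nhds.1 hg (ε / 2) (half_pos hε)] with i hi
  have h1 : ‖f i - g i‖ ≤ ‖f - g‖ := (f - g).norm_apply_le K i
  have h2 : ‖f i‖ ≤ ‖f i - g i‖ + ‖g i‖ := by simpa using norm_add_le (f i - g i) (g i)
  rw [dist_eq_norm] at hfg
  simp only [dist_zero_right, norm_norm] at hi ⊢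
  linarith

/-- The Banach algebra ultraproduct of the algebras `C(K i)` of real continuous functions: bounded
families modulo families that tend to zero in norm along `𝒰`, with the quotient norm. -/
def Ultraproduct (𝒰 : Ultrafilter I) : Type _ := BoundedFamilies K ⧸ nullIdeal K 𝒰

noncomputable instance (𝒰 : Ultrafilter I) : NormedCommRing (Ultraproduct K 𝒰) :=
  Ideal.Quotient.normedCommRing (nullIdeal K 𝒰)

noncomputable instance (𝒰 : Ultrafilter I) : NormedAlgebra ℝ (Ultraproduct K 𝒰) :=
  Ideal.Quotient.normedAlgebra (nullIdeal K 𝒰) ℝ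

/-- The topological ultracoproduct of the `K i` along `𝒰`: the (Gelfand) spectrum of the
ultraproduct of the algebras `C(K i)`, that is the space of its nonzero continuous multiplicative
real linear functionals, with the weak-star topology. -/
abbrev Ultracoproduct (𝒰 : Ultrafilter I) : Type _ :=
  WeakDual.characterSpace ℝ (Ultraproduct K 𝒰)

end Ultracoproduct

end Tunnels

namespace Tunnels

section Points

variable {I : Type*} {K : I → Type*} [∀ i, TopologicalSpace (K i)] [∀ i, CompactSpace (K i)]
  [∀ i, Nonempty (K i)] (𝒰 : Ultrafilter I)

/-! Families `U i ∈ W i` give open sets `ultraOpen 𝒰 U`. As `𝒰` is an ultrafilter, one of the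
alternatives defining the order holds at almost all indices, and Urysohn functions carry closure
inclusions over (`closure_ultraOpen_subset`). For density, a nonempty open set contains a nonempty
set `ψ g < δ` (`exists_forall_lt_imp_mem`); almost all `g i` take small values
(`eventually_exists_lt`), hence do so at frontier points of members of `W i`, and the limit of these
is a frontier point (`ultraPoint_mem_frontier_ultraOpen`). -/

instance : CompleteSpace (BoundedFamilies K) :=
  inferInstanceAs (CompleteSpace (lp (fun i => C(K i, ℝ)) ∞))

/-- Completeness makes characters automatically continuous, so `ultraPoint` can be built from a bare
algebra homomorphism. -/
instance : CompleteSpace (Ultraproduct K 𝒰) :=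
  inferInstanceAs (CompleteSpace (BoundedFamilies K ⧸ (nullIdeal K 𝒰).toAddSubgroup))

instance : AlgHomClass (Ultracoproduct K 𝒰) ℝ (Ultraproduct K 𝒰) ℝ :=
  WeakDual.CharacterSpace.instAlgHomClass (𝕜 := ℝ) (A := Ultraproduct K 𝒰)

/-- The class of a bounded family in the ultraproduct. -/
noncomputable def toUltraproduct : BoundedFamilies K →ₐ[ℝ] Ultraproduct K 𝒰 :=
  Ideal.Quotient.mkₐ ℝ (nullIdeal K 𝒰)

theorem toUltraproduct_surjective :
    Function.Surjective (toUltraproduct (K := K) 𝒰) :=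
  Ideal.Quotient.mk_surjective

theorem toUltraproduct_eq_of_eventuallyEq {f g : BoundedFamilies K}
    (h : ∀ᶠ i in 𝒰, f i = g i) : toUltraproduct 𝒰 f = toUltraproduct 𝒰 g := by
  refine Ideal.Quotient.eq.2 ?_
  change Tendsto (fun i => ‖f i - g i‖) 𝒰 (𝓝 0)
  refine tendsto_const_nhds.congr' ?_
  filter_upwards [h] with i hi
  simp [hi]

/-- A uniformly bounded family of continuous functions. -/
def BoundedFamilies.mk (f : ∀ i, C(K i, ℝ)) (c : ℝ) (h : ∀ i, ‖f i‖ ≤ c) :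
    BoundedFamilies K :=
  ⟨f, memℓp_infty ⟨c, by rintro _ ⟨i, rfl⟩; exact h i⟩⟩

theorem BoundedFamilies.abs_apply_le (f : BoundedFamilies K) (i : I) (x : K i) :
    |f i x| ≤ ‖f‖ :=
  ((f i).norm_coe_le_norm x).trans (f.norm_apply_le K i)

theorem exists_tendsto_eval (x : ∀ i, K i) (f : BoundedFamilies K) :
    ∃ l, Tendsto (fun i => f i (x i)) 𝒰 (𝓝 l) := by
  have hmem : ∀ᶠ i in 𝒰, f i (x i) ∈ Set.Icc (-‖f‖) ‖f‖ :=
    Eventually.of_forall fun i => abs_le.1 (f.abs_apply_le i (x i))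
  obtain ⟨l, -, hl⟩ := isCompact_Icc.ultrafilter_le_nhds
    (𝒰.map fun i => f i (x i)) (le_principal_iff.2 hmem)
  exact ⟨l, hl⟩

/-- The limit along `𝒰` of the evaluations at the points `x i`. -/
noncomputable def evalLimit (x : ∀ i, K i) : BoundedFamilies K →ₐ[ℝ] ℝ :=
  have h (f : BoundedFamilies K) := (exists_tendsto_eval 𝒰 x f).choose_spec
  AlgHom.ofLinearMap
    { toFun f := (exists_tendsto_eval 𝒰 x f).choose
      map_add' f g := tendsto_nhds_unique (h (f + g)) ((h f).add (h g))
      map_smul' c f := tendsto_nhds_unique (h (c • f)) ((h f).const_mul c) }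
    (tendsto_nhds_unique (h 1) tendsto_const_nhds)
    (fun f g => tendsto_nhds_unique (h (f * g)) ((h f).mul (h g)))

theorem tendsto_evalLimit (x : ∀ i, K i) (f : BoundedFamilies K) :
    Tendsto (fun i => f i (x i)) 𝒰 (𝓝 (evalLimit 𝒰 x f)) :=
  (exists_tendsto_eval 𝒰 x f).choose_spec

theorem evalLimit_eq_zero_of_mem (x : ∀ i, K i) (f : BoundedFamilies K)
    (hf : f ∈ nullIdeal K 𝒰) : evalLimit 𝒰 x f = 0 :=
  tendsto_nhds_unique (tendsto_evalLimit 𝒰 x f)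
    (squeeze_zero_norm (fun i => (f i).norm_coe_le_norm (x i)) hf)

/-- The point of the ultracoproduct represented by a family of points. -/
noncomputable def ultraPoint (x : ∀ i, K i) : Ultracoproduct K 𝒰 :=
  WeakDual.CharacterSpace.equivAlgHom.symm
    (Ideal.Quotient.liftₐ (nullIdeal K 𝒰) (evalLimit 𝒰 x) (evalLimit_eq_zero_of_mem 𝒰 x))

theorem tendsto_ultraPoint (x : ∀ i, K i) (f : BoundedFamilies K) :
    Tendsto (fun i => f i (x i)) 𝒰 (𝓝 (ultraPoint 𝒰 x (toUltraproduct 𝒰 f))) :=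
  tendsto_evalLimit 𝒰 x f

theorem continuous_apply_toUltraproduct (f : BoundedFamilies K) :
    Continuous fun φ : Ultracoproduct K 𝒰 => φ (toUltraproduct 𝒰 f) :=
  (WeakDual.eval_continuous (toUltraproduct 𝒰 f)).comp continuous_subtype_val

variable {𝒰}

/-- Neighbourhoods in the ultracoproduct are controlled by single elements. -/
theorem exists_forall_lt_imp_mem {O : Set (Ultracoproduct K 𝒰)} (hO : IsOpen O)
    {φ : Ultracoproduct K 𝒰} (hφ : φ ∈ O) :
    ∃ g : BoundedFamilies K, φ (toUltraproduct 𝒰 g) = 0 ∧ ∃ δ > 0,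
      ∀ ψ : Ultracoproduct K 𝒰, ψ (toUltraproduct 𝒰 g) < δ → ψ ∈ O := by
  have hind : Topology.IsInducing
      fun (ψ : Ultracoproduct K 𝒰) (a : Ultraproduct K 𝒰) => ψ a :=
    (⟨rfl⟩ : Topology.IsInducing
      fun (ψ : WeakDual ℝ (Ultraproduct K 𝒰)) (a : Ultraproduct K 𝒰) => ψ a).comp
      Topology.IsInducing.subtypeVal
  obtain ⟨T, hT, rfl⟩ := hind.isOpen_iff.1 hO
  obtain ⟨F, u, hu, hFu⟩ := isOpen_pi_iff.1 hT _ hφ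
  have hε : ∃ ε > 0, ∀ a ∈ F, Metric.ball (φ a) ε ⊆ u a := by
    have h : ∀ᶠ ε : ℝ in 𝓝[>] 0, ∀ a ∈ F, Metric.ball (φ a) ε ⊆ u a := by
      refine (Filter.eventually_all_finset F).2 fun a ha => ?_
      obtain ⟨ε, hε, h⟩ := Metric.isOpen_iff.1 (hu a ha).1 _ (hu a ha).2
      filter_upwards [Ioo_mem_nhdsGT hε] with η hη
      exact (Metric.ball_subset_ball hη.2.le).trans h
    obtain ⟨ε, h1, h2⟩ := (h.and self_mem_nhdsWithin).exists
    exact ⟨ε, h2, h1⟩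
  obtain ⟨ε, hε, hball⟩ := hε
  -- A sum of squares merges the finitely many weak-star conditions into one: if it is below `ε ^
  -- 2`, so is each term.
  obtain ⟨g, hg⟩ := toUltraproduct_surjective 𝒰
    (∑ a ∈ F, (a - algebraMap ℝ (Ultraproduct K 𝒰) (φ a)) ^ 2)
  have key (ψ : Ultracoproduct K 𝒰) :
      ψ (toUltraproduct 𝒰 g) = ∑ a ∈ F, (ψ a - φ a) ^ 2 := by
    rw [hg, map_sum]
    refine Finset.sum_congr rfl fun a _ => ?_
    rw [map_pow, map_sub, AlgHomClass.commutes]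
    rfl
  refine ⟨g, by simp [key], ε ^ 2, by positivity, fun ψ hψ => hFu fun a ha => hball a ha ?_⟩
  rw [key] at hψ
  have h1 := Finset.single_le_sum (f := fun a => (ψ a - φ a) ^ 2)
    (fun a _ => sq_nonneg _) (Finset.mem_coe.1 ha)
  rw [Metric.mem_ball, Real.dist_eq]
  exact abs_lt_of_sq_lt_sq (h1.trans_lt hψ) hε.le

/-- A family in the kernel of a character takes small values on sets of indices in `𝒰`. -/
theorem eventually_exists_lt {φ : Ultracoproduct K 𝒰} {g : BoundedFamilies K}
    (hg : φ (toUltraproduct 𝒰 g) = 0) {δ : ℝ} (hδ : 0 < δ) :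
    ∀ᶠ i in 𝒰, ∃ x, g i x < δ := by
  by_contra hcon
  have hge : ∀ᶠ i in 𝒰, ∀ x, δ ≤ g i x := by
    filter_upwards [Ultrafilter.eventually_not.2 hcon] with i hi x
    exact not_lt.1 fun h => hi ⟨x, h⟩
  -- The truncation at `δ` bounds `k` at every index; at almost all indices it is inactive, so `k`
  -- inverts `g`, which no character killing `g` allows.
  let k : BoundedFamilies K := .mk
    (fun i => ⟨fun x => (max (g i x) δ)⁻¹, ((g i).continuous.max continuous_const).inv₀
      fun x => (hδ.trans_le (le_max_right _ _)).ne'⟩) δ⁻¹ fun i => by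
      refine (ContinuousMap.norm_le _ (by positivity)).2 fun x => ?_
      have h : 0 < max (g i x) δ := hδ.trans_le (le_max_right _ _)
      rw [ContinuousMap.coe_mk, Real.norm_of_nonneg (inv_nonneg.2 h.le)]
      exact inv_anti₀ hδ (le_max_right _ _)
  have h1 : toUltraproduct 𝒰 (g * k) = toUltraproduct 𝒰 1 := by
    refine toUltraproduct_eq_of_eventuallyEq 𝒰 ?_
    filter_upwards [hge] with i hi
    ext x
    change g i x * (max (g i x) δ)⁻¹ = 1
    rw [max_eq_left (hi x), mul_inv_cancel₀ (hδ.trans_le (hi x)).ne']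
  have h2 := congrArg φ h1
  rw [map_mul, map_mul, hg, zero_mul, map_one, map_one] at h2
  exact zero_ne_one h2

theorem ultraPoint_le {x : ∀ i, K i} {g : BoundedFamilies K} {δ : ℝ}
    (h : ∀ᶠ i in 𝒰, g i (x i) ≤ δ) : ultraPoint 𝒰 x (toUltraproduct 𝒰 g) ≤ δ :=
  le_of_tendsto (tendsto_ultraPoint 𝒰 x g) h

end Points

/-! ### Open sets of the ultracoproduct and their frontiers -/

section OpenSets

variable {I : Type*} {K : I → Type*} [∀ i, TopologicalSpace (K i)] [∀ i, CompactSpace (K i)]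
  [∀ i, Nonempty (K i)] (𝒰 : Ultrafilter I)

/-- The open subset of the ultracoproduct determined by a family of sets: the characters which do
not vanish on all families supported in these sets. -/
def ultraOpen (U : ∀ i, Set (K i)) : Set (Ultracoproduct K 𝒰) :=
  {φ | ∃ f : BoundedFamilies K, (∀ᶠ i in 𝒰, ∀ x ∉ U i, f i x = 0) ∧ φ (toUltraproduct 𝒰 f) ≠ 0}

theorem isOpen_ultraOpen (U : ∀ i, Set (K i)) : IsOpen (ultraOpen 𝒰 U) := by
  refine isOpen_iff_mem_nhds.2 fun φ ⟨f, hf, hφ⟩ => ?_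
  filter_upwards [(continuous_apply_toUltraproduct 𝒰 f).continuousAt.eventually_ne hφ] with ψ hψ
  exact ⟨f, hf, hψ⟩

variable {𝒰}

theorem ultraPoint_notMem_ultraOpen {U : ∀ i, Set (K i)} {x : ∀ i, K i}
    (h : ∀ᶠ i in 𝒰, x i ∉ U i) : ultraPoint 𝒰 x ∉ ultraOpen 𝒰 U := by
  rintro ⟨f, hf, hne⟩
  refine hne (tendsto_nhds_unique (tendsto_ultraPoint 𝒰 x f) (tendsto_const_nhds.congr' ?_))
  filter_upwards [h, hf] with i hi hfi
  exact (hfi _ hi).symm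

theorem ultraOpen_congr {U V : ∀ i, Set (K i)} (h : ∀ᶠ i in 𝒰, U i = V i) :
    ultraOpen 𝒰 U = ultraOpen 𝒰 V := by
  ext φ
  refine exists_congr fun f => and_congr_left fun _ => eventually_congr ?_
  filter_upwards [h] with i hi
  rw [hi]

variable [∀ i, T2Space (K i)]

/-- Urysohn's lemma for families of closed sets inside open sets. -/
theorem exists_family_eq_one_eq_zero {C V : ∀ i, Set (K i)}
    (h : ∀ᶠ i in 𝒰, IsClosed (C i) ∧ IsOpen (V i) ∧ C i ⊆ V i) :
    ∃ f : BoundedFamilies K,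
      ∀ᶠ i in 𝒰, (∀ x ∈ C i, f i x = 1) ∧ ∀ x ∉ V i, f i x = 0 := by
  have hex (i : I) : ∃ f : C(K i, ℝ), ‖f‖ ≤ 1 ∧
      (IsClosed (C i) ∧ IsOpen (V i) ∧ C i ⊆ V i →
        (∀ x ∈ C i, f x = 1) ∧ ∀ x ∉ V i, f x = 0) := by
    by_cases hi : IsClosed (C i) ∧ IsOpen (V i) ∧ C i ⊆ V i
    · obtain ⟨f, h0, h1, h01⟩ := exists_continuous_zero_one_of_isClosed
        hi.2.1.isClosed_compl hi.1 (Set.disjoint_left.2 fun x hx hxC => hx (hi.2.2 hxC))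
      refine ⟨f, (ContinuousMap.norm_le _ zero_le_one).2 fun x => ?_, fun _ => ⟨h1, h0⟩⟩
      rw [Real.norm_of_nonneg (h01 x).1]
      exact (h01 x).2
    · exact ⟨0, by simp, fun h => absurd h hi⟩
  choose f hf hfs using hex
  exact ⟨.mk f 1 hf, h.mono fun i hi => hfs i hi⟩

theorem ultraPoint_mem_ultraOpen {U : ∀ i, Set (K i)} {x : ∀ i, K i}
    (h : ∀ᶠ i in 𝒰, IsOpen (U i) ∧ x i ∈ U i) : ultraPoint 𝒰 x ∈ ultraOpen 𝒰 U := by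
  obtain ⟨f, hf⟩ := exists_family_eq_one_eq_zero (𝒰 := 𝒰) (C := fun i => {x i}) (V := U)
    (h.mono fun i hi => ⟨isClosed_singleton, hi.1, Set.singleton_subset_iff.2 hi.2⟩)
  refine ⟨f, hf.mono fun i hi => hi.2, ?_⟩
  have h1 : ultraPoint 𝒰 x (toUltraproduct 𝒰 f) = 1 := by
    refine tendsto_nhds_unique (tendsto_ultraPoint 𝒰 x f) (tendsto_const_nhds.congr' ?_)
    filter_upwards [hf] with i hi
    exact (hi.1 _ rfl).symm
  rw [h1]
  exact one_ne_zero

theorem closure_ultraOpen_subset {U V : ∀ i, Set (K i)}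
    (h : ∀ᶠ i in 𝒰, IsOpen (V i) ∧ closure (U i) ⊆ V i) :
    closure (ultraOpen 𝒰 U) ⊆ ultraOpen 𝒰 V := by
  obtain ⟨f, hf⟩ := exists_family_eq_one_eq_zero (𝒰 := 𝒰) (C := fun i => closure (U i)) (V := V)
    (h.mono fun i hi => ⟨isClosed_closure, hi⟩)
  -- `f` acts as a unit on families supported in `U`, and the condition `φ f = 1` is closed.
  have hsub : ultraOpen 𝒰 U ⊆ {φ | φ (toUltraproduct 𝒰 f) = 1} := by
    rintro φ ⟨k, hk, hne⟩
    have h1 : toUltraproduct 𝒰 (k * f) = toUltraproduct 𝒰 k := by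
      refine toUltraproduct_eq_of_eventuallyEq 𝒰 ?_
      filter_upwards [hk, hf] with i hki hfi
      ext x
      change k i x * f i x = k i x
      by_cases hx : x ∈ U i
      · rw [hfi.1 x (subset_closure hx), mul_one]
      · rw [hki x hx, zero_mul]
    have h2 := congrArg φ h1
    rw [map_mul, map_mul] at h2
    exact mul_left_cancel₀ hne (h2.trans (mul_one _).symm)
  intro φ hφ
  have h1 : φ (toUltraproduct 𝒰 f) = 1 :=
    closure_minimal hsub (isClosed_eq (continuous_apply_toUltraproduct 𝒰 f) continuous_const) hφ
  exact ⟨f, hf.mono fun i hi => hi.2, h1 ▸ one_ne_zero⟩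

theorem ultraPoint_mem_frontier_ultraOpen {U : ∀ i, Set (K i)} {x : ∀ i, K i}
    (h : ∀ᶠ i in 𝒰, IsOpen (U i) ∧ x i ∈ frontier (U i)) :
    ultraPoint 𝒰 x ∈ frontier (ultraOpen 𝒰 U) := by
  rw [(isOpen_ultraOpen 𝒰 U).frontier_eq]
  refine ⟨mem_closure_iff.2 fun O hO hxO => ?_, ultraPoint_notMem_ultraOpen ?_⟩
  · obtain ⟨g, hg, δ, hδ, hgO⟩ := exists_forall_lt_imp_mem hO hxO
    -- Limits keep only weak inequalities, so `δ / 2` leaves room for a strict bound by `δ`.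
    have hsmall : ∀ᶠ i in 𝒰, g i (x i) < δ / 2 :=
      (tendsto_ultraPoint 𝒰 x g).eventually_lt_const (hg ▸ half_pos hδ)
    have hy : ∀ᶠ i in 𝒰, ∃ y ∈ U i, g i y < δ / 2 := by
      filter_upwards [h, hsmall] with i hi hgi
      obtain ⟨y, hy, hyU⟩ := mem_closure_iff.1 (frontier_subset_closure hi.2) _
        (isOpen_lt (g i).continuous continuous_const) hgi
      exact ⟨y, hyU, hy⟩
    obtain ⟨y, hy⟩ := Filter.skolem.1 hy
    refine ⟨ultraPoint 𝒰 y, hgO _ (lt_of_le_of_lt (ultraPoint_le ?_) (half_lt_self hδ)),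
      ultraPoint_mem_ultraOpen ?_⟩
    · exact hy.mono fun i hi => hi.2.le
    · filter_upwards [h, hy] with i hi hyi
      exact ⟨hi.1, hyi.1⟩
  · filter_upwards [h] with i hi
    have hx := hi.2
    rw [hi.1.frontier_eq] at hx
    exact hx.2

/-- The open sets determined by families of members of tunnels form a tunnel. -/
theorem isTunnel_ultraOpen {W : ∀ i, Set (Set (K i))} (hW : ∀ i, IsTunnel (W i)) :
    IsTunnel (ultraOpen 𝒰 '' {U : ∀ i, Set (K i) | ∀ i, U i ∈ W i}) where
  isOpen := by
    rintro _ ⟨U, -, rfl⟩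
    exact isOpen_ultraOpen 𝒰 U
  chain := by
    have key {U V : ∀ i, Set (K i)} (hV : ∀ i, V i ∈ W i)
        (h : ∀ᶠ i in 𝒰, ChainLE (U i) (V i)) : ChainLE (ultraOpen 𝒰 U) (ultraOpen 𝒰 V) := by
      refine (Ultrafilter.eventually_or.1 h).imp (fun h => ?_) ultraOpen_congr
      exact closure_ultraOpen_subset (h.mono fun i hi => ⟨(hW i).isOpen _ (hV i), hi⟩)
    rintro _ ⟨U, hU, rfl⟩ _ ⟨V, hV, rfl⟩
    refine (Ultrafilter.eventually_or.1 (Eventually.of_forall fun i =>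
      (hW i).chain _ (hU i) _ (hV i))).imp (key hV) (key hU)
  dense := by
    refine dense_iff_inter_open.2 fun O hO ⟨φ, hφ⟩ => ?_
    obtain ⟨g, hg, δ, hδ, hgO⟩ := exists_forall_lt_imp_mem hO hφ
    -- At the negligible indices where `g i` is nowhere small, any frontier point serves.
    have hfr (i : I) : ∃ x, ∃ U ∈ W i, x ∈ frontier U ∧ ((∃ z, g i z < δ / 2) → g i x < δ / 2) := by
      have hd (S : Set (K i)) (hS : IsOpen S) (hne : S.Nonempty) :
          ∃ x ∈ S, ∃ U ∈ W i, x ∈ frontier U := by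
        obtain ⟨x, hx, hxU⟩ := (hW i).dense.inter_open_nonempty S hS hne
        simp only [Set.mem_iUnion, exists_prop] at hxU
        exact ⟨x, hx, hxU⟩
      by_cases hz : ∃ z, g i z < δ / 2
      · obtain ⟨x, hx, U, hU, hxU⟩ :=
          hd _ (isOpen_lt (g i).continuous (continuous_const (y := δ / 2))) hz
        exact ⟨x, U, hU, hxU, fun _ => hx⟩
      · obtain ⟨x, -, U, hU, hxU⟩ := hd _ isOpen_univ Set.univ_nonempty
        exact ⟨x, U, hU, hxU, fun h => absurd h hz⟩
    choose x U hU hxU hx using hfr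
    refine ⟨ultraPoint 𝒰 x, hgO _ (lt_of_le_of_lt (ultraPoint_le ?_) (half_lt_self hδ)), ?_⟩
    · exact (eventually_exists_lt hg (half_pos hδ)).mono fun i hi => (hx i hi).le
    · refine Set.mem_biUnion (Set.mem_image_of_mem _ hU) (ultraPoint_mem_frontier_ultraOpen ?_)
      exact Eventually.of_forall fun i => ⟨(hW i).isOpen _ (hU i), hxU i⟩

end OpenSets

end Tunnels

theorem proposition2p16 {I : Type*} (K : I → Type*) [∀ i, TopologicalSpace (K i)]
    [∀ i, CompactSpace (K i)] [∀ i, T2Space (K i)] [∀ i, Nonempty (K i)]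
    (𝒰 : Ultrafilter I) (h𝒰 : Tunnels.CountablyIncomplete 𝒰)
    (hK : ∀ i, Tunnels.HasTunnel (K i)) :
    Tunnels.HasTunnel (Tunnels.Ultracoproduct K 𝒰) := by
  choose W hW using hK
  exact ⟨_, Tunnels.isTunnel_ultraOpen hW⟩
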